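/- Let $H$ be a complex separable Hilbert space (inner product linear in the first variable), and let $\{x_k\}_{k=1}^\infty$ and $\{y_k\}_{k=1}^\infty$ be sequences in $H$ such that for every $u\in H$ the series $$Tu=\sum_{k=1}^\infty \langle u,y_k\rangle x_k$$ converges unconditionally in $H$. Then there exists a sequence of nonzero complex numbers $\{\alpha_k\}_{k=1}^\infty$ such that both $\{\alpha_k x_k\}_{k=1}^\infty$ and $\{\overline{\alpha}_k^{-1}y_k\}_{k=1}^\infty$ are Bessel sequences. Here a sequence $\{z_k\}_{k=1}^\infty$ in $H$ is called Bessel if there is a constant $C>0$ such that $\sum_{k=1}^\infty|\langle u,z_k\rangle|^2\le C\|u\|^2$ for all $u\in H$. -/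

import Mathlib

/-- The sequence `x` is `C`-Bessel in the complex Hilbert space `H`: for every `u` the series
`∑ₖ |⟨u, xₖ⟩|²` converges and its sum is at most `C ‖u‖²`. -/
def IsBesselWith {H : Type*} [NormedAddCommGroup H] [InnerProductSpace ℂ H]
    (C : ℝ) (x : ℕ → H) : Prop :=
  ∀ u : H, Summable (fun k => ‖inner ℂ (x k) u‖ ^ 2) ∧
    ∑' k, ‖inner ℂ (x k) u‖ ^ 2 ≤ C * ‖u‖ ^ 2

/-- The sequence `x` is Bessel: it is `C`-Bessel for some constant `C > 0`. -/
def IsBessel {H : Type*} [NormedAddCommGroup H] [InnerProductSpace ℂ H] (x : ℕ → H) : Prop :=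
  ∃ C : ℝ, 0 < C ∧ IsBesselWith C x

/-! Unconditional convergence and Banach–Steinhaus give `∑ |⟨u, xₖ⟩| |⟨v, yₖ⟩| ≤ M ‖u‖ ‖v‖`. It
suffices to find weights with `wₖ vₖ ≥ 1` for which `∑ wₖ |⟨u, xₖ⟩|²` and `∑ vₖ |⟨u', yₖ⟩|²` are
bounded on the unit ball; then `αₖ = √wₖ` works.

The weights come from a minimax argument. The admissible pairs form a compact convex set, so by
Hahn–Banach and compactness it is enough to treat one finite convex combination of the constraints
at a time. Such a combination replaces `|⟨u, xₖ⟩|`, `|⟨u', yₖ⟩|` by square functions `Pₖ`, `Qₖ`, and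
the choice `wₖ ≈ Qₖ / Pₖ`, `vₖ ≈ Pₖ / Qₖ` costs about `2 ∑ Pₖ Qₖ`. Khintchine's inequality, with
independent signs for the two families, bounds `∑ Pₖ Qₖ` by `4 M`. -/

/-- The sum of `v i` over `i ∈ s`, taken with sign `+` for `i ∈ t` and `-` for `i ∉ t`. -/
noncomputable def signedSum {ι E : Type*} [AddCommGroup E] (v : ι → E) (s t : Finset ι) : E :=
  open Classical in ∑ i ∈ s, if i ∈ t then v i else -v i

/-- The average of `f` over all signed sums of the family `v` over `s`. -/
noncomputable def signAverage {ι E : Type*} [AddCommGroup E] (v : ι → E) (s : Finset ι)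
    (f : E → ℝ) : ℝ :=
  (∑ t ∈ s.powerset, f (signedSum v s t)) / 2 ^ s.card

/-! ### Averages over random signs -/

section SignAverage

variable {ι E : Type*} [AddCommGroup E] (v : ι → E) (s : Finset ι)

lemma signAverage_mono {f g : E → ℝ} (h : ∀ z, f z ≤ g z) :
    signAverage v s f ≤ signAverage v s g := by
  unfold signAverage
  gcongr
  exact h _

lemma signAverage_add (f g : E → ℝ) :
    signAverage v s (fun z => f z + g z) = signAverage v s f + signAverage v s g := by
  simp only [signAverage, Finset.sum_add_distrib, add_div]

lemma signAverage_const_mul (c : ℝ) (f : E → ℝ) :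
    signAverage v s (fun z => c * f z) = c * signAverage v s f := by
  simp only [signAverage, ← Finset.mul_sum, mul_div_assoc]

lemma signAverage_const (c : ℝ) : signAverage v s (fun _ => c) = c := by
  simp [signAverage]

lemma signAverage_sum {κ : Type*} (F : Finset κ) (f : κ → E → ℝ) :
    signAverage v s (fun z => ∑ k ∈ F, f k z) = ∑ k ∈ F, signAverage v s (f k) := by
  simp only [signAverage]
  rw [Finset.sum_comm, Finset.sum_div]

lemma signAverage_map {E' : Type*} [AddCommGroup E'] (φ : E →+ E') (f : E' → ℝ) :
    signAverage (fun i => φ (v i)) s f = signAverage v s (fun z => f (φ z)) := by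
  simp only [signAverage, signedSum, map_sum, apply_ite φ, map_neg]

lemma signAverage_insert [DecidableEq ι] {a : ι} (ha : a ∉ s) (f : E → ℝ) :
    signAverage v (insert a s) f =
      signAverage v s (fun z => (f (z + v a) + f (z - v a)) / 2) := by
  have h₁ : ∀ t ∈ s.powerset, f (signedSum v (insert a s) t) = f (signedSum v s t - v a) := by
    intro t ht
    have hat : a ∉ t := fun h => ha (Finset.mem_powerset.1 ht h)
    rw [signedSum, signedSum, Finset.sum_insert ha, if_neg hat, neg_add_eq_sub]
  have h₂ : ∀ t ∈ s.powerset,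
      f (signedSum v (insert a s) (insert a t)) = f (signedSum v s t + v a) := by
    intro t ht
    have : ∀ i ∈ s, i ≠ a := fun i hi h => ha (h ▸ hi)
    rw [signedSum, signedSum, Finset.sum_insert ha, if_pos (Finset.mem_insert_self a t), add_comm]
    congr 2
    refine Finset.sum_congr rfl fun i hi => ?_
    simp [Finset.mem_insert, this i hi]
  rw [signAverage, Finset.sum_powerset_insert ha, Finset.sum_congr rfl h₁,
    Finset.sum_congr rfl h₂, Finset.card_insert_of_notMem ha, signAverage, pow_succ,
    ← Finset.sum_div, Finset.sum_add_distrib]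
  field_simp
  ring

end SignAverage

/-! ### Khintchine's inequality by the fourth-moment method -/

section Khintchine

variable {ι E : Type*} [NormedAddCommGroup E] [InnerProductSpace ℂ E] (v : ι → E) (s : Finset ι)

lemma signAverage_norm_sq : signAverage v s (fun z => ‖z‖ ^ 2) = ∑ i ∈ s, ‖v i‖ ^ 2 := by
  classical
  induction s using Finset.induction_on with
  | empty => simp [signAverage, signedSum]
  | insert a s ha ih =>
    have h : ∀ z : E, (‖z + v a‖ ^ 2 + ‖z - v a‖ ^ 2) / 2 = ‖z‖ ^ 2 + ‖v a‖ ^ 2 := fun z => by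
      have := parallelogram_law_with_norm ℂ z (v a)
      linarith
    rw [signAverage_insert v s ha, Finset.sum_insert ha]
    simp only [h]
    rw [signAverage_add, signAverage_const, ih, add_comm]

lemma norm_add_pow_four_add_norm_sub_pow_four_le (z w : E) :
    (‖z + w‖ ^ 4 + ‖z - w‖ ^ 4) / 2 ≤ ‖z‖ ^ 4 + 6 * ‖w‖ ^ 2 * ‖z‖ ^ 2 + ‖w‖ ^ 4 := by
  have h₁ := norm_add_sq (𝕜 := ℂ) z w
  have h₂ := norm_sub_sq (𝕜 := ℂ) z w
  set r := RCLike.re (inner ℂ z w)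
  have hr : r ^ 2 ≤ (‖z‖ * ‖w‖) ^ 2 :=
    sq_le_sq.2 ((RCLike.abs_re_le_norm _).trans
      ((norm_inner_le_norm z w).trans (le_abs_self _)))
  have e₁ : ‖z + w‖ ^ 4 = (‖z‖ ^ 2 + 2 * r + ‖w‖ ^ 2) ^ 2 := by rw [← h₁]; ring
  have e₂ : ‖z - w‖ ^ 4 = (‖z‖ ^ 2 - 2 * r + ‖w‖ ^ 2) ^ 2 := by rw [← h₂]; ring
  rw [e₁, e₂]
  linarith

/-- Conditioning on one sign at a time, the cross term `6 ‖v a‖² ‖z‖²` averages to `6 ‖v a‖² ∑ ‖v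
i‖²`, exactly the cross term of the square on the right. -/
lemma signAverage_norm_pow_four_le :
    signAverage v s (fun z => ‖z‖ ^ 4) ≤ 3 * (∑ i ∈ s, ‖v i‖ ^ 2) ^ 2 := by
  classical
  induction s using Finset.induction_on with
  | empty => simp [signAverage, signedSum]
  | insert a s ha ih =>
    rw [signAverage_insert v s ha, Finset.sum_insert ha]
    refine (signAverage_mono v s fun z =>
      norm_add_pow_four_add_norm_sub_pow_four_le z (v a)).trans ?_
    rw [signAverage_add, signAverage_add, signAverage_const, signAverage_const_mul,
      signAverage_norm_sq]
    nlinarith [sq_nonneg (‖v a‖ ^ 2)]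

/-- The `L¹`-`L²` Khintchine inequality, with constant `2`. -/
lemma sqrt_sum_norm_sq_le_signAverage :
    √(∑ i ∈ s, ‖v i‖ ^ 2) ≤ 2 * signAverage v s (fun z => ‖z‖) := by
  set σ := √(∑ i ∈ s, ‖v i‖ ^ 2)
  have hσ : σ ^ 2 = ∑ i ∈ s, ‖v i‖ ^ 2 := Real.sq_sqrt (by positivity)
  have hA : 0 ≤ signAverage v s (fun z => ‖z‖) := by
    unfold signAverage; positivity
  rcases (Real.sqrt_nonneg _ : 0 ≤ σ).eq_or_lt with h0 | h0
  · change σ ≤ _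
    have : σ = 0 := h0.symm
    rw [this]; positivity
  -- The cubic `r³ - 12σ²r + 16σ³` has a double root at `r = 2σ`. Averaging with the second and
  -- fourth moments gives `9σ ≤ 16 A`, where `A` is the mean norm.
  have key : ∀ z : E, 12 * σ ^ 2 * ‖z‖ ^ 2 ≤ 16 * σ ^ 3 * ‖z‖ + ‖z‖ ^ 4 := fun z => by
    have : 0 ≤ ‖z‖ * ((‖z‖ - 2 * σ) ^ 2 * (‖z‖ + 4 * σ)) := by positivity
    nlinarith
  have h := signAverage_mono v s key
  rw [signAverage_add, signAverage_const_mul, signAverage_const_mul, signAverage_norm_sq,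
    ← hσ] at h
  have h4 := signAverage_norm_pow_four_le v s
  rw [← hσ] at h4
  have h5 : σ ^ 3 * (9 * σ) ≤ σ ^ 3 * (16 * signAverage v s (fun z => ‖z‖)) := by linarith
  have := le_of_mul_le_mul_left h5 (by positivity)
  linarith

lemma signAverage_norm_le : signAverage v s (fun z => ‖z‖) ≤ (∑ i ∈ s, ‖v i‖ ^ 2 + 1) / 2 := by
  have h := signAverage_mono v s (f := fun z => 2 * ‖z‖) (g := fun z => ‖z‖ ^ 2 + 1)
    fun z => by nlinarith [sq_nonneg (‖z‖ - 1)]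
  rw [signAverage_const_mul, signAverage_add, signAverage_const, signAverage_norm_sq] at h
  linarith

end Khintchine

/-! ### A finite minimax principle -/

/-- If finitely many convex functions on a convex set `K` are such that every convex combination
of them takes a value `≤ c` on `K`, then for `c < c'` they are all `< c'` at a common point. -/
lemma exists_forall_lt_of_forall_convexCombination_le {E ι : Type*} [AddCommGroup E] [Module ℝ E]
    [Fintype ι] {K : Set E} (hK : K.Nonempty) (f : ι → E → ℝ)
    (hf : ∀ i, ConvexOn ℝ K (f i)) (hKc : Convex ℝ K) {c c' : ℝ} (hc : c < c')
    (h : ∀ l : ι → ℝ, (∀ i, 0 ≤ l i) → ∑ i, l i = 1 → ∃ w ∈ K, ∑ i, l i * f i w ≤ c) :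
    ∃ w ∈ K, ∀ i, f i w < c' := by
  classical
  by_contra hcon
  push Not at hcon
  let S : Set (ι → ℝ) := {z | ∃ w ∈ K, ∀ i, f i w < z i}
  have hSconv : Convex ℝ S := by
    rintro z ⟨w, hw, hz⟩ z' ⟨w', hw', hz'⟩ a b ha hb hab
    refine ⟨a • w + b • w', hKc hw hw' ha hb hab, fun i => ?_⟩
    refine ((hf i).2 hw hw' ha hb hab).trans_lt ?_
    simp only [Pi.add_apply, Pi.smul_apply, smul_eq_mul]
    rcases ha.eq_or_lt with rfl | ha'
    · have : b = 1 := by linarith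
      subst this
      simpa using hz' i
    · have h1 := mul_lt_mul_of_pos_left (hz i) ha'
      have h2 := mul_le_mul_of_nonneg_left (hz' i).le hb
      linarith
  have hSopen : IsOpen S := by
    have : S = ⋃ w ∈ K, Set.univ.pi fun i => Set.Ioi (f i w) := by
      ext z; simp [S]
    rw [this]
    exact isOpen_biUnion fun w _ => isOpen_set_pi Set.finite_univ fun i _ => isOpen_Ioi
  have hnot : (fun _ => c') ∉ S := by
    rintro ⟨w, hw, hlt⟩
    obtain ⟨i, hi⟩ := hcon w hw
    exact (hi.trans_lt (hlt i)).false
  -- The functional separates the constant vector `c'` from the upward-closed set `S`; its negated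
  -- coefficients, once normalised, are the forbidden convex combination.
  obtain ⟨φ, hφ⟩ := geometric_hahn_banach_open_point hSconv hSopen hnot
  set l : ι → ℝ := fun i => -φ (Pi.single i 1)
  have hφl : ∀ z : ι → ℝ, φ z = -∑ i, l i * z i := fun z => by
    conv_lhs => rw [pi_eq_sum_univ' z, map_sum]
    rw [← Finset.sum_neg_distrib]
    refine Finset.sum_congr rfl fun i _ => ?_
    rw [map_smul, smul_eq_mul]
    simp [l, mul_comm]
  obtain ⟨w₀, hw₀⟩ := hK
  have hl : ∀ i, 0 ≤ l i := by
    intro i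
    by_contra hneg
    push Not at hneg
    -- `S` contains a ray in direction `i`, along which a negative `l i` would make `φ` unbounded
    -- above.
    have hmem : ∀ n : ℝ, 0 ≤ n → (fun j => f j w₀ + 1 + n * (Pi.single i 1 : ι → ℝ) j) ∈ S := by
      intro n hn
      refine ⟨w₀, hw₀, fun j => ?_⟩
      have : 0 ≤ n * (Pi.single i 1 : ι → ℝ) j :=
        mul_nonneg hn (by by_cases hj : j = i <;> simp [hj])
      linarith
    have hb : ∀ n : ℝ, 0 ≤ n →
        -(∑ j, l j * (f j w₀ + 1)) - n * l i < φ (fun _ => c') := by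
      intro n hn
      have := hφ _ (hmem n hn)
      rw [hφl] at this
      have e : ∑ j, l j * (f j w₀ + 1 + n * (Pi.single i 1 : ι → ℝ) j) =
          ∑ j, l j * (f j w₀ + 1) + n * l i := by
        simp only [mul_add, Finset.sum_add_distrib]
        simp [Pi.single_apply, mul_comm]
      rw [e] at this
      linarith
    set A := -(∑ j, l j * (f j w₀ + 1))
    set B := φ (fun _ => c')
    have := hb (|B - A| / (-l i)) (by have : 0 < -l i := by linarith
                                      positivity)
    have e : |B - A| / (-l i) * l i = -|B - A| := by
      have : l i ≠ 0 := hneg.ne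
      field_simp
    rw [e] at this
    linarith [le_abs_self (B - A)]
  have hsum : 0 < ∑ i, l i := by
    refine (Finset.sum_nonneg fun i _ => hl i).lt_of_ne fun h0 => ?_
    have hz : ∀ i, l i = 0 := fun i =>
      (Finset.sum_eq_zero_iff_of_nonneg fun i _ => hl i).1 h0.symm i (Finset.mem_univ i)
    have := hφ (fun i => f i w₀ + 1) ⟨w₀, hw₀, fun i => by linarith⟩
    simp [hφl, hz] at this
  set s := ∑ i, l i
  obtain ⟨w, hw, hle⟩ := h (fun i => l i / s) (fun i => div_nonneg (hl i) hsum.le)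
    (by rw [← Finset.sum_div]; exact div_self hsum.ne')
  have h1 : ∑ i, l i * f i w ≤ c * s := by
    have e : ∑ i, l i / s * f i w = (∑ i, l i * f i w) / s := by
      rw [Finset.sum_div]; exact Finset.sum_congr rfl fun i _ => by ring
    rw [e, div_le_iff₀ hsum] at hle
    exact hle
  have h2 := hφ (fun i => f i w + (c' - c) ) ⟨w, hw, fun i => by linarith⟩
  rw [hφl, hφl] at h2
  simp only [mul_add, Finset.sum_add_distrib, ← Finset.sum_mul] at h2
  change -(_ + s * (c' - c)) < -(s * c') at h2
  linarith

/-! ### Uniform bounds for the multiplier -/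

section Multiplier

variable {H : Type*} [NormedAddCommGroup H] [InnerProductSpace ℂ H] {x y : ℕ → H}

/-- An unconditionally convergent multiplier is uniformly weakly unconditionally bounded. -/
lemma exists_sum_norm_inner_mul_norm_inner_le [CompleteSpace H]
    (hT : ∀ u : H, Summable (fun k => inner ℂ (y k) u • x k)) :
    ∃ M : ℝ, 0 ≤ M ∧ ∀ (u v : H) (F : Finset ℕ),
      ∑ k ∈ F, ‖inner ℂ (x k) u‖ * ‖inner ℂ (y k) v‖ ≤ M * ‖u‖ * ‖v‖ := by
  -- Finite partial sums with arbitrary coefficients in the unit disc. Banach–Steinhaus is applied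
  -- twice: from weak to pointwise boundedness, then to a norm bound.
  let T : Finset ℕ × (ℕ → Metric.closedBall (0 : ℂ) 1) → H →L[ℂ] H := fun p =>
    ∑ k ∈ p.1, (p.2 k : ℂ) • (innerSL ℂ (y k)).smulRight (x k)
  have hTapp : ∀ p u, T p u = ∑ k ∈ p.1, (p.2 k : ℂ) • (inner ℂ (y k) u • x k) := by
    intro p u
    simp [T]
  have hsum : ∀ u v : H, Summable fun k => ‖inner ℂ v (inner ℂ (y k) u • x k)‖ := fun u v =>
    ((hT u).mapL (innerSL ℂ v)).norm
  have hpt : ∀ u, ∃ C, ∀ p, ‖T p u‖ ≤ C := by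
    intro u
    obtain ⟨C, hC⟩ := banach_steinhaus (g := fun p => innerSL ℂ (T p u)) (fun v => by
      refine ⟨∑' k, ‖inner ℂ v (inner ℂ (y k) u • x k)‖, fun p => ?_⟩
      rw [innerSL_apply_apply, norm_inner_symm, hTapp, inner_sum]
      refine (norm_sum_le _ _).trans (le_trans (Finset.sum_le_sum fun k _ => ?_)
        ((hsum u v).sum_le_tsum p.1 fun _ _ => norm_nonneg _))
      rw [inner_smul_right, norm_mul]
      exact mul_le_of_le_one_left (norm_nonneg _) (mem_closedBall_zero_iff.1 (p.2 k).2))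
    exact ⟨C, fun p => by simpa using hC p⟩
  obtain ⟨M, hM⟩ := banach_steinhaus hpt
  refine ⟨M, (norm_nonneg _).trans (hM (∅, fun _ => ⟨0, by simp⟩)), fun u v F => ?_⟩
  let z : ℕ → ℂ := fun k => inner ℂ u (inner ℂ (y k) v • x k)
  -- Phases that make every term nonnegative; where `z k = 0` the quotient is `0`.
  let a : ℕ → Metric.closedBall (0 : ℂ) 1 := fun k => ⟨(‖z k‖ : ℂ) / z k, by
    simpa using div_self_le_one ‖z k‖⟩
  have ha : ∀ k, (a k : ℂ) * z k = ‖z k‖ := fun k => by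
    by_cases h : z k = 0
    · simp [a, h]
    · exact div_mul_cancel₀ _ h
  have e : inner ℂ u (T (F, a) v) = ((∑ k ∈ F, ‖z k‖ : ℝ) : ℂ) := by
    rw [hTapp, inner_sum]
    push_cast
    refine Finset.sum_congr rfl fun k _ => ?_
    rw [inner_smul_right, ← ha]
  have e' : ∀ k, ‖inner ℂ (x k) u‖ * ‖inner ℂ (y k) v‖ = ‖z k‖ := fun k => by
    simp only [z]
    rw [inner_smul_right, norm_mul, norm_inner_symm (x k) u, mul_comm]
  calc ∑ k ∈ F, ‖inner ℂ (x k) u‖ * ‖inner ℂ (y k) v‖ = ∑ k ∈ F, ‖z k‖ :=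
        Finset.sum_congr rfl fun k _ => e' k
    _ = ‖inner ℂ u (T (F, a) v)‖ := by
        rw [e, Complex.norm_real, Real.norm_of_nonneg (by positivity)]
    _ ≤ ‖u‖ * ‖T (F, a) v‖ := norm_inner_le_norm _ _
    _ ≤ ‖u‖ * (M * ‖v‖) := by
        gcongr
        exact (T (F, a)).le_of_opNorm_le (hM _) v
    _ = M * ‖u‖ * ‖v‖ := by ring

/-- A bound on `∑ |⟨u, xₖ⟩| |⟨v, yₖ⟩|` over vectors self-improves, by Khintchine's inequality, to
one over square functions. -/
lemma sum_sqrt_mul_sqrt_le {M : ℝ} (hM₀ : 0 ≤ M)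
    (hM : ∀ (u v : H) (F : Finset ℕ),
      ∑ k ∈ F, ‖inner ℂ (x k) u‖ * ‖inner ℂ (y k) v‖ ≤ M * ‖u‖ * ‖v‖)
    {ι : Type*} (s : Finset ι) (u v : ι → H) (hu : ∑ i ∈ s, ‖u i‖ ^ 2 ≤ 1)
    (hv : ∑ i ∈ s, ‖v i‖ ^ 2 ≤ 1) (F : Finset ℕ) :
    ∑ k ∈ F, √(∑ i ∈ s, ‖inner ℂ (x k) (u i)‖ ^ 2) * √(∑ i ∈ s, ‖inner ℂ (y k) (v i)‖ ^ 2)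
      ≤ 4 * M := by
  have hkh : ∀ (a : H) (w : ι → H), √(∑ i ∈ s, ‖inner ℂ a (w i)‖ ^ 2) ≤
      2 * signAverage w s (fun z => ‖inner ℂ a z‖) := fun a w => by
    refine (sqrt_sum_norm_sq_le_signAverage (fun i => inner ℂ a (w i)) s).trans_eq ?_
    exact congrArg (2 * ·)
      (signAverage_map w s (innerSL ℂ a : H →ₗ[ℂ] ℂ).toAddMonoidHom (fun z => ‖z‖))
  have hle : ∀ w : ι → H, ∑ i ∈ s, ‖w i‖ ^ 2 ≤ 1 → signAverage w s (fun z => ‖z‖) ≤ 1 :=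
    fun w hw => (signAverage_norm_le w s).trans (by linarith)
  have h0 : 0 ≤ signAverage v s (fun z => ‖z‖) := by
    unfold signAverage; positivity
  calc _ ≤ ∑ k ∈ F, (2 * signAverage u s (fun z => ‖inner ℂ (x k) z‖)) *
        (2 * signAverage v s (fun z => ‖inner ℂ (y k) z‖)) := by
        exact Finset.sum_le_sum fun k _ => mul_le_mul (hkh _ _) (hkh _ _) (Real.sqrt_nonneg _)
          ((Real.sqrt_nonneg _).trans (hkh _ _))
    _ = 4 * signAverage u s (fun z => signAverage v s (fun z' =>
          ∑ k ∈ F, ‖inner ℂ (x k) z‖ * ‖inner ℂ (y k) z'‖)) := by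
        simp_rw [signAverage_sum, Finset.mul_sum, signAverage_const_mul]
        refine Finset.sum_congr rfl fun k _ => ?_
        simp_rw [mul_comm _ (signAverage v s _), signAverage_const_mul]
        ring
    _ ≤ 4 * signAverage u s (fun z => signAverage v s (fun z' => M * ‖z‖ * ‖z'‖)) := by
        gcongr
        exact signAverage_mono _ _ fun z => signAverage_mono _ _ fun z' => hM z z' F
    _ = 4 * (M * (signAverage u s (fun z => ‖z‖) * signAverage v s (fun z => ‖z‖))) := by
        simp_rw [signAverage_const_mul, mul_assoc, mul_comm _ (signAverage v s _),
          signAverage_const_mul]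
    _ ≤ 4 * (M * (1 * 1)) := by
        gcongr
        · exact hle u hu
        · exact hle v hv
    _ = 4 * M := by ring

end Multiplier

/-! ### Choice of the weights -/

section Weights

variable {H : Type*} [NormedAddCommGroup H] [InnerProductSpace ℂ H] {x y : ℕ → H}

/-- The pairs `(w, v)` of weights with `0 ≤ w ≤ b`, `0 ≤ v ≤ b'` and `w v ≥ 1`. -/
def weightPairs (b b' : ℕ → ℝ) : Set ((ℕ → ℝ) × (ℕ → ℝ)) :=
  Set.Icc (0, 0) (b, b') ∩ {p | ∀ k, 1 ≤ p.1 k * p.2 k}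

lemma isCompact_weightPairs (b b' : ℕ → ℝ) : IsCompact (weightPairs b b') := by
  refine isCompact_Icc.inter_right ?_
  rw [Set.ofPred_forall]
  exact isClosed_iInter fun k => isClosed_le (by fun_prop) (by fun_prop)

/-- By AM-GM the mixed term `p₁q₂ + q₁p₂` is at least `2`. The condition `w v = 1` would not be
convex. -/
lemma convex_weightPairs (b b' : ℕ → ℝ) : Convex ℝ (weightPairs b b') := by
  rintro p ⟨hp, hp'⟩ q ⟨hq, hq'⟩ s t hs ht hst
  refine ⟨convex_Icc _ _ hp hq hs ht hst, fun k => ?_⟩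
  have hp1 : 0 ≤ p.1 k := hp.1.1 k
  have hp2 : 0 ≤ p.2 k := hp.1.2 k
  have hq1 : 0 ≤ q.1 k := hq.1.1 k
  have hq2 : 0 ≤ q.2 k := hq.1.2 k
  have h1 : 1 ≤ p.1 k * p.2 k := hp' k
  have h2 : 1 ≤ q.1 k * q.2 k := hq' k
  have h3 : 2 ≤ p.1 k * q.2 k + q.1 k * p.2 k := by
    refine abs_le_of_sq_le_sq' ?_ (by positivity) |>.2
    nlinarith [sq_nonneg (p.1 k * q.2 k - q.1 k * p.2 k),
      mul_le_mul h1 h2 zero_le_one (by positivity)]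
  have h4 : (s + t) ^ 2 = 1 := by rw [hst]; norm_num
  change 1 ≤ (s * p.1 k + t * q.1 k) * (s * p.2 k + t * q.2 k)
  nlinarith [mul_le_mul_of_nonneg_left h1 (mul_nonneg hs hs),
    mul_le_mul_of_nonneg_left h2 (mul_nonneg ht ht),
    mul_le_mul_of_nonneg_left h3 (mul_nonneg hs ht)]

/-- A bound on `∑ |⟨u, xₖ⟩| |⟨v, yₖ⟩|` yields weights making `x` and `y` simultaneously Bessel. -/
lemma exists_weights {M : ℝ} (hM₀ : 0 ≤ M)
    (hM : ∀ (u v : H) (F : Finset ℕ),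
      ∑ k ∈ F, ‖inner ℂ (x k) u‖ * ‖inner ℂ (y k) v‖ ≤ M * ‖u‖ * ‖v‖) :
    ∃ C : ℝ, 0 < C ∧ ∃ w v : ℕ → ℝ, (∀ k, 0 ≤ w k) ∧ (∀ k, 0 ≤ v k) ∧ (∀ k, 1 ≤ w k * v k) ∧
      ∀ u u' : H, ‖u‖ ≤ 1 → ‖u'‖ ≤ 1 → ∀ F : Finset ℕ,
        ∑ k ∈ F, (w k * ‖inner ℂ (x k) u‖ ^ 2 + v k * ‖inner ℂ (y k) u'‖ ^ 2) ≤ C := by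
  -- `γ` and `δ` keep the quotients below well defined, yet the cross terms they create are
  -- summable. `b` and `b'` dominate every optimal weight, whatever the convex combination.
  let t : ℕ → ℝ := fun k => (1 / 2) ^ k
  let γ : ℕ → ℝ := fun k => t k / (1 + ‖y k‖)
  let δ : ℕ → ℝ := fun k => t k / (1 + ‖x k‖)
  let b : ℕ → ℝ := fun k => (‖y k‖ + δ k) / γ k
  let b' : ℕ → ℝ := fun k => (‖x k‖ + γ k) / δ k
  have ht : ∀ k, 0 < t k := fun k => by positivity
  have ht1 : ∀ k, t k ≤ 1 := fun k => pow_le_one₀ (by norm_num) (by norm_num)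
  have hts : ∀ F : Finset ℕ, ∑ k ∈ F, t k ≤ 2 := fun F =>
    (summable_geometric_two.sum_le_tsum F fun k _ => (ht k).le).trans_eq tsum_geometric_two
  have hγ : ∀ k, 0 < γ k := fun k => by have := ht k; positivity
  have hδ : ∀ k, 0 < δ k := fun k => by have := ht k; positivity
  have hγy : ∀ k, γ k * ‖y k‖ ≤ t k := fun k => by
    rw [div_mul_eq_mul_div, div_le_iff₀ (by positivity)]
    nlinarith [ht k]
  have hδx : ∀ k, ‖x k‖ * δ k ≤ t k := fun k => by
    rw [mul_div_assoc', div_le_iff₀ (by positivity)]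
    nlinarith [ht k]
  have hγδ : ∀ k, γ k * δ k ≤ t k := fun k => by
    have h1 : γ k ≤ t k := div_le_self (ht k).le (by linarith [norm_nonneg (y k)])
    have h2 : δ k ≤ 1 :=
      (div_le_self (ht k).le (by linarith [norm_nonneg (x k)])).trans (ht1 k)
    nlinarith [hγ k, hδ k]
  let I := Finset ℕ × Metric.closedBall (0 : H) 1 × Metric.closedBall (0 : H) 1
  let f : I → (ℕ → ℝ) × (ℕ → ℝ) → ℝ := fun i p =>
    ∑ k ∈ i.1, (p.1 k * ‖inner ℂ (x k) (i.2.1 : H)‖ ^ 2 +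
      p.2 k * ‖inner ℂ (y k) (i.2.2 : H)‖ ^ 2)
  have hfcont : ∀ i, Continuous (f i) := fun i => by fun_prop
  have hfconv : ∀ i, ConvexOn ℝ (weightPairs b b') (f i) := fun i => by
    refine ⟨convex_weightPairs b b', fun p _ q _ r s _ _ _ => le_of_eq ?_⟩
    simp only [f, Prod.fst_add, Prod.snd_add, Prod.smul_fst, Prod.smul_snd, Pi.add_apply,
      Pi.smul_apply, smul_eq_mul, Finset.mul_sum, ← Finset.sum_add_distrib]
    exact Finset.sum_congr rfl fun k _ => by ring
  -- for each convex combination the optimal weights are explicit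
  have hcomb : ∀ (J : Finset I) (l : J → ℝ), (∀ i, 0 ≤ l i) → ∑ i, l i = 1 →
      ∃ p ∈ weightPairs b b', ∑ i, l i * f i p ≤ 8 * M + 12 := by
    intro J l hl hl1
    have hnorm : ∀ z : Metric.closedBall (0 : H) 1, ‖(z : H)‖ ≤ 1 := fun z =>
      mem_closedBall_zero_iff.1 z.2
    -- Absorbing `√(l i)` into the vectors turns the convex combination into square functions.
    let u : J → H := fun i => (√(l i) : ℂ) • (i.1.2.1 : H)
    let u' : J → H := fun i => (√(l i) : ℂ) • (i.1.2.2 : H)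
    have hsm : ∀ (r : ℝ), 0 ≤ r → ∀ z : H, ‖(√r : ℂ) • z‖ ^ 2 = r * ‖z‖ ^ 2 := by
      intro r hr z
      rw [norm_smul, mul_pow, Complex.norm_real, Real.norm_of_nonneg (Real.sqrt_nonneg _),
        Real.sq_sqrt hr]
    have hin : ∀ (r : ℝ), 0 ≤ r → ∀ a z : H,
        ‖inner ℂ a ((√r : ℂ) • z)‖ ^ 2 = r * ‖inner ℂ a z‖ ^ 2 := by
      intro r hr a z
      rw [inner_smul_right, norm_mul, mul_pow, Complex.norm_real,
        Real.norm_of_nonneg (Real.sqrt_nonneg _), Real.sq_sqrt hr]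
    have hle1 : ∀ z : J → Metric.closedBall (0 : H) 1,
        ∑ i, ‖(√(l i) : ℂ) • (z i : H)‖ ^ 2 ≤ 1 := fun z => by
      refine le_trans (Finset.sum_le_sum fun i _ => ?_) hl1.le
      rw [hsm _ (hl i)]
      exact mul_le_of_le_one_right (hl i) (pow_le_one₀ (norm_nonneg _) (hnorm _))
    let P : ℕ → ℝ := fun k => √(∑ i, ‖inner ℂ (x k) (u i)‖ ^ 2)
    let Q : ℕ → ℝ := fun k => √(∑ i, ‖inner ℂ (y k) (u' i)‖ ^ 2)
    have hPQ : ∀ F : Finset ℕ, ∑ k ∈ F, P k * Q k ≤ 4 * M := fun F =>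
      sum_sqrt_mul_sqrt_le hM₀ hM Finset.univ u u' (hle1 _) (hle1 _) F
    have hbound : ∀ (a : H) (z : J → H), ∑ i, ‖z i‖ ^ 2 ≤ 1 →
        √(∑ i, ‖inner ℂ a (z i)‖ ^ 2) ≤ ‖a‖ := fun a z hz => by
      refine Real.sqrt_le_iff.2 ⟨norm_nonneg _, ?_⟩
      calc ∑ i, ‖inner ℂ a (z i)‖ ^ 2 ≤ ∑ i, ‖a‖ ^ 2 * ‖z i‖ ^ 2 := by
            gcongr with i
            rw [← mul_pow]
            gcongr
            exact norm_inner_le_norm _ _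
        _ ≤ ‖a‖ ^ 2 := by
            rw [← Finset.mul_sum]
            exact mul_le_of_le_one_right (by positivity) hz
    have hP : ∀ k, P k ≤ ‖x k‖ := fun k => hbound _ _ (hle1 _)
    have hQ : ∀ k, Q k ≤ ‖y k‖ := fun k => hbound _ _ (hle1 _)
    have hP0 : ∀ k, 0 ≤ P k := fun k => Real.sqrt_nonneg _
    have hQ0 : ∀ k, 0 ≤ Q k := fun k => Real.sqrt_nonneg _
    have hPγ : ∀ k, 0 < P k + γ k := fun k => add_pos_of_nonneg_of_pos (hP0 k) (hγ k)
    have hQδ : ∀ k, 0 < Q k + δ k := fun k => add_pos_of_nonneg_of_pos (hQ0 k) (hδ k)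
    have hP2 : ∀ k, ∑ i : J, l i * ‖inner ℂ (x k) (i.1.2.1 : H)‖ ^ 2 = P k ^ 2 := fun k => by
      rw [Real.sq_sqrt (by positivity)]
      exact Finset.sum_congr rfl fun i _ => (hin _ (hl i) _ _).symm
    have hQ2 : ∀ k, ∑ i : J, l i * ‖inner ℂ (y k) (i.1.2.2 : H)‖ ^ 2 = Q k ^ 2 := fun k => by
      rw [Real.sq_sqrt (by positivity)]
      exact Finset.sum_congr rfl fun i _ => (hin _ (hl i) _ _).symm
    let w : ℕ → ℝ := fun k => (Q k + δ k) / (P k + γ k)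
    let v : ℕ → ℝ := fun k => (P k + γ k) / (Q k + δ k)
    have hw : ∀ k, 0 < w k := fun k => div_pos (hQδ k) (hPγ k)
    have hv : ∀ k, 0 < v k := fun k => div_pos (hPγ k) (hQδ k)
    refine ⟨(w, v), ⟨⟨⟨fun k => (hw k).le, fun k => (hv k).le⟩,
      ⟨fun k => ?_, fun k => ?_⟩⟩, fun k => ?_⟩, ?_⟩
    · exact div_le_div₀ (add_nonneg (norm_nonneg _) (hδ k).le) (by linarith [hQ k]) (hγ k)
        (by linarith [hP0 k])
    · exact div_le_div₀ (add_nonneg (norm_nonneg _) (hγ k).le) (by linarith [hP k]) (hδ k)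
        (by linarith [hQ0 k])
    · change 1 ≤ (Q k + δ k) / (P k + γ k) * ((P k + γ k) / (Q k + δ k))
      have := (hPγ k).ne'
      have := (hQδ k).ne'
      field_simp
      rfl
    let F : Finset ℕ := J.biUnion Prod.fst
    -- Both terms are at most `(P + γ)(Q + δ)`, whose three error products are each at most `t k`.
    have hterm : ∀ k, w k * P k ^ 2 + v k * Q k ^ 2 ≤ 2 * (P k * Q k + 3 * t k) := fun k => by
      have h1 : w k * P k ^ 2 ≤ (P k + γ k) * (Q k + δ k) := by
        calc w k * P k ^ 2 ≤ w k * (P k + γ k) ^ 2 := by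
              have := hP0 k
              have := (hγ k).le
              have := (hw k).le
              gcongr
              linarith
          _ = (P k + γ k) * (Q k + δ k) := by
              have := (hPγ k).ne'
              simp only [w]
              field_simp
      have h2 : v k * Q k ^ 2 ≤ (P k + γ k) * (Q k + δ k) := by
        calc v k * Q k ^ 2 ≤ v k * (Q k + δ k) ^ 2 := by
              have := hQ0 k
              have := (hδ k).le
              have := (hv k).le
              gcongr
              linarith
          _ = (P k + γ k) * (Q k + δ k) := by
              have := (hQδ k).ne'
              simp only [v]
              field_simp
      have h3 : P k * δ k ≤ t k :=
        (mul_le_mul_of_nonneg_right (hP k) (hδ k).le).trans (hδx k)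
      have h4 : γ k * Q k ≤ t k :=
        (mul_le_mul_of_nonneg_left (hQ k) (hγ k).le).trans (hγy k)
      linarith [hγδ k]
    calc ∑ i : J, l i * f i (w, v)
        ≤ ∑ i : J, l i * ∑ k ∈ F, (w k * ‖inner ℂ (x k) (i.1.2.1 : H)‖ ^ 2 +
            v k * ‖inner ℂ (y k) (i.1.2.2 : H)‖ ^ 2) := by
          refine Finset.sum_le_sum fun i _ => mul_le_mul_of_nonneg_left ?_ (hl i)
          refine Finset.sum_le_sum_of_subset_of_nonneg
            (Finset.subset_biUnion_of_mem Prod.fst i.2) fun k _ _ => ?_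
          have := (hw k).le
          have := (hv k).le
          positivity
      _ = ∑ k ∈ F, (w k * P k ^ 2 + v k * Q k ^ 2) := by
          simp_rw [← hP2, ← hQ2, Finset.mul_sum, ← Finset.sum_add_distrib]
          rw [Finset.sum_comm]
          exact Finset.sum_congr rfl fun k _ => Finset.sum_congr rfl fun i _ => by ring
      _ ≤ ∑ k ∈ F, 2 * (P k * Q k + 3 * t k) := Finset.sum_le_sum fun k _ => hterm k
      _ = 2 * ∑ k ∈ F, P k * Q k + 6 * ∑ k ∈ F, t k := by
          simp only [← Finset.mul_sum, Finset.sum_add_distrib]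
          ring
      _ ≤ 8 * M + 12 := by linarith [hPQ F, hts F]
  have hne : (weightPairs b b').Nonempty := by
    obtain ⟨p, hp, -⟩ := hcomb {(∅, ⟨0, by simp⟩, ⟨0, by simp⟩)} (fun _ => 1)
      (fun _ => zero_le_one) (by simp)
    exact ⟨p, hp⟩
  -- Finite intersection property: finitely many constraints are met simultaneously by the minimax
  -- principle, hence all of them are.
  obtain ⟨p, hp, hpf⟩ := (isCompact_weightPairs b b').inter_iInter_nonempty
    (fun i : I => {p | f i p ≤ 8 * M + 13})
    (fun i => isClosed_le (hfcont i) continuous_const) fun J => by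
      obtain ⟨p, hp, h⟩ := exists_forall_lt_of_forall_convexCombination_le hne
        (fun i : J => f i) (fun i => hfconv i) (convex_weightPairs b b')
        (show 8 * M + 12 < 8 * M + 13 by linarith) (hcomb J)
      exact ⟨p, hp, Set.mem_iInter₂.2 fun i hi => (h ⟨i, hi⟩).le⟩
  refine ⟨8 * M + 13, by positivity, p.1, p.2, hp.1.1.1, hp.1.1.2, hp.2, fun u u' hu hu' F => ?_⟩
  exact Set.mem_iInter.1 hpf
    (F, ⟨u, mem_closedBall_zero_iff.2 hu⟩, ⟨u', mem_closedBall_zero_iff.2 hu'⟩)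

lemma isBesselWith_of_sum_le {C : ℝ} (z : ℕ → H)
    (h : ∀ u : H, ‖u‖ ≤ 1 → ∀ F : Finset ℕ, ∑ k ∈ F, ‖inner ℂ (z k) u‖ ^ 2 ≤ C) :
    IsBesselWith C z := by
  intro u
  have hF : ∀ F : Finset ℕ, ∑ k ∈ F, ‖inner ℂ (z k) u‖ ^ 2 ≤ C * ‖u‖ ^ 2 := fun F => by
    rcases eq_or_ne u 0 with rfl | hu
    · simp
    have hu' : 0 < ‖u‖ := norm_pos_iff.2 hu
    have h1 := h ((‖u‖⁻¹ : ℂ) • u) (by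
      rw [norm_smul, norm_inv, Complex.norm_real, norm_norm, inv_mul_cancel₀ hu'.ne']) F
    have h2 : ∀ k, ‖inner ℂ (z k) ((‖u‖⁻¹ : ℂ) • u)‖ ^ 2 =
        ‖inner ℂ (z k) u‖ ^ 2 / ‖u‖ ^ 2 := fun k => by
      rw [inner_smul_right, norm_mul, norm_inv, Complex.norm_real, norm_norm, mul_pow, inv_pow]
      ring
    simp_rw [h2, ← Finset.sum_div] at h1
    rwa [div_le_iff₀ (by positivity)] at h1
  have hs := summable_of_sum_le (fun k => sq_nonneg ‖inner ℂ (z k) u‖) hF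
  exact ⟨hs, hs.tsum_le_of_sum_le hF⟩

end Weights

/-- The inner product `⟨u, y⟩` that is linear in `u` is `inner ℂ y u`, and `Summable` is
unconditional convergence of the series. -/
theorem theorem1p2 {H : Type*} [NormedAddCommGroup H] [InnerProductSpace ℂ H] [CompleteSpace H]
    [TopologicalSpace.SeparableSpace H] (x y : ℕ → H)
    (hT : ∀ u : H, Summable (fun k => inner ℂ (y k) u • x k)) :
    ∃ α : ℕ → ℂ, (∀ k, α k ≠ 0) ∧ IsBessel (fun k => α k • x k) ∧
      IsBessel (fun k => (starRingEnd ℂ (α k))⁻¹ • y k) := by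
  obtain ⟨M, hM₀, hM⟩ := exists_sum_norm_inner_mul_norm_inner_le hT
  obtain ⟨C, hC, w, v, hw, hv, hwv, hsum⟩ := exists_weights hM₀ hM
  have hw' : ∀ k, 0 < w k := fun k =>
    (hw k).lt_of_ne fun h => by have := hwv k; rw [← h, zero_mul] at this; linarith
  refine ⟨fun k => (√(w k) : ℂ), fun k => ?_, ⟨C, hC, ?_⟩, ⟨C, hC, ?_⟩⟩
  · exact Complex.ofReal_ne_zero.2 (Real.sqrt_pos.2 (hw' k)).ne'
  · refine isBesselWith_of_sum_le _ fun u hu F => le_trans (Finset.sum_le_sum fun k _ => ?_)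
      (hsum u 0 hu (by simp) F)
    rw [inner_smul_left, norm_mul, RCLike.norm_conj, Complex.norm_real, mul_pow,
      Real.norm_of_nonneg (Real.sqrt_nonneg _), Real.sq_sqrt (hw k)]
    simp
  · refine isBesselWith_of_sum_le _ fun u hu F => le_trans (Finset.sum_le_sum fun k _ => ?_)
      (hsum 0 u (by simp) hu F)
    rw [inner_smul_left, norm_mul, RCLike.norm_conj, norm_inv, RCLike.norm_conj,
      Complex.norm_real, mul_pow, inv_pow,
      Real.norm_of_nonneg (Real.sqrt_nonneg _), Real.sq_sqrt (hw k)]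
    have : (w k)⁻¹ ≤ v k := by
      rw [inv_le_iff_one_le_mul₀ (hw' k), mul_comm]
      exact hwv k
    simp only [inner_zero_right, norm_zero]
    nlinarith [mul_le_mul_of_nonneg_right this (sq_nonneg ‖inner ℂ (y k) u‖)]
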